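/- Let $\Gamma$ be a divisible (totally) ordered abelian group, equipped with its order topology; let $\Gamma^n$ carry the product topology and subsets of $\Gamma^n$ the subspace topology. "Definable" means first-order definable with parameters from $\Gamma$ in the language of ordered abelian groups; a function is definable if its graph is. A function $\Gamma^n\to\Gamma$ is called $\mathbb{Q}$-affine if it has the form $x\mapsto \sum_{j=1}^n q_jx_j+c$ with $q_j\in\mathbb{Q}$ and $c\in\Gamma$. A subset $C\subseteq\Gamma^n$ is called convex if $\frac{u+v}{2}\in C$ for all $u,v\in C$. For functions $h,f_1,\dots,f_m$ on a set $X$ with values in $\Gamma$, $h$ is called a $w$-combination of $f_1,\dots,f_m$ if for every $x\in X$ there is $i$ with $h(x)=f_i(x)$, and an $\ell$-combination of $f_1,\dots,f_m$ if it lies in the lattice of functions generated by $f_1,\dots,f_m$ under pointwise $\min$ and $\max$. (Functions $f_i$ on $\Gamma^n$ are restricted to a subset where necessary.) Let $m\ge 1$, let $f_1,\dots,f_m$ be $\mathbb{Q}$-affine functions on $\Gamma^n$, let $D\subseteq\Gamma^n$ be definable, and let $g:D\to\Gamma$ be a continuous definable function that is a $w$-combination of $f_1,\dots,f_m$. Then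 the following are equivalent: 1. $g$ is an $\ell$-combination of $f_1,\dots,f_m$. 2. $g$ extends to a continuous definable function $g':\Gamma^n\to\Gamma$ that is a $w$-combination of $f_1,\dots,f_m$. 3. $g$ extends to a continuous definable function $g':D'\to\Gamma$, on some convex definable set $D'\subseteq\Gamma^n$ containing $D$, that is a $w$-combination of $f_1,\dots,f_m$. 4. For all $x,y\in D$ there is $i\in\{1,\dots,m\}$ such that $f_i(x)\le g(x)$ and $g(y)\le f_i(y)$. 5. For some nonempty collection $S$ of nonempty subsets of $\{1,\dots,m\}$, $g=\min_{X\in S}\max_{i\in X}f_i$ on $D$. -/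

import Mathlib

namespace DOAG

/-! ### The first-order language of ordered abelian groups -/

/-- The function symbols `0`, `-`, `+` of the language of ordered abelian groups. -/
inductive OagFunc : ℕ → Type
  | zero : OagFunc 0
  | neg : OagFunc 1
  | add : OagFunc 2

/-- The relation symbol `≤` of the language of ordered abelian groups. -/
inductive OagRel : ℕ → Type
  | le : OagRel 2

/-- The language `(0, -, +, ≤)` of ordered abelian groups. -/
def oag : FirstOrder.Language.{0, 0} where
  Functions := OagFunc
  Relations := OagRel

/-- Every ordered abelian group is a structure in the language of ordered abelian groups. -/
instance oagStructure {Γ : Type*} [AddCommGroup Γ] [LinearOrder Γ] :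
    oag.Structure Γ where
  funMap := fun f v =>
    match f with
    | OagFunc.zero => (0 : Γ)
    | OagFunc.neg => -v 0
    | OagFunc.add => v 0 + v 1
  RelMap := fun r v =>
    match r with
    | OagRel.le => v 0 ≤ v 1

section

variable {Γ : Type*} [AddCommGroup Γ] [LinearOrder Γ]

/-- `D ⊆ Γⁿ` is definable, with parameters from `Γ`, in the ordered group `Γ`. -/
def IsDefinable {ι : Type*} (D : Set (ι → Γ)) : Prop :=
  (Set.univ : Set Γ).Definable oag D

/-- A function `g : D → Γ` on a subset `D ⊆ Γⁿ` is definable (with parameters) if its graph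
`{(x, y) | x ∈ D, g x = y} ⊆ Γⁿ × Γ` is; a point `v` of `Γⁿ × Γ` is written here as a function
on `Option (Fin n)`, with `x = (v (some j))_j` and `y = v none`. -/
def IsDefinableFun {n : ℕ} {D : Set (Fin n → Γ)} (g : D → Γ) : Prop :=
  IsDefinable {v : Option (Fin n) → Γ | ∃ h : (fun j => v (some j)) ∈ D,
    g ⟨fun j => v (some j), h⟩ = v none}

end

/-! ### Combinations of functions -/

/-- `g` is a `w`-combination of the `f i`: at every point, `g` agrees with some `f i`. -/
def IsWCombination {X ι Γ : Type*} (g : X → Γ) (f : ι → X → Γ) : Prop :=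
  ∀ x, ∃ i, g x = f i x

/-- `g` is an `ℓ`-combination of the `f i`: it lies in the lattice of functions generated by the
`f i` under the pointwise operations `min` and `max`. -/
def IsLCombination {X ι Γ : Type*} [LinearOrder Γ] (g : X → Γ) (f : ι → X → Γ) : Prop :=
  g ∈ latticeClosure (Set.range f)

/-! ### Affine functions and convexity

A divisible ordered abelian group is torsion-free, so it carries exactly one structure of
`ℚ`-vector space, and conversely every `ℚ`-vector space is divisible. Divisibility is therefore
expressed by `Module ℚ Γ`. -/

section

variable {Γ : Type*} [AddCommGroup Γ] [Module ℚ Γ]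

/-- `f : Γⁿ → Γ` is `ℚ`-affine: `f x = ∑ j, q j • x j + c` with `q j ∈ ℚ` and `c ∈ Γ`. -/
def IsQAffine {n : ℕ} (f : (Fin n → Γ) → Γ) : Prop :=
  ∃ (q : Fin n → ℚ) (c : Γ), ∀ x, f x = ∑ j, q j • x j + c

/-- `D ⊆ Γⁿ` is convex: it contains `(u + v) / 2` whenever it contains `u` and `v`. -/
def IsConvex {n : ℕ} (D : Set (Fin n → Γ)) : Prop :=
  ∀ u ∈ D, ∀ v ∈ D, (1 / 2 : ℚ) • (u + v) ∈ D

end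

section

variable {Γ : Type*} [AddCommGroup Γ] [LinearOrder Γ] [TopologicalSpace Γ]

/-- `g : D → Γ` extends to a continuous definable function `g' : D' → Γ` that is a
`w`-combination of (the restrictions to `D'` of) the `f i`. Here `Γ` carries its order topology,
`Γⁿ` the product topology and `D'` the subspace topology. -/
def HasWExtension {n m : ℕ} (f : Fin m → (Fin n → Γ) → Γ) {D : Set (Fin n → Γ)} (g : D → Γ)
    (D' : Set (Fin n → Γ)) : Prop :=
  ∃ (hD : D ⊆ D') (g' : D' → Γ), Continuous g' ∧ IsDefinableFun g' ∧
    IsWCombination g' (fun i (x : D') => f i x) ∧ ∀ x : D, g' ⟨x, hD x.2⟩ = g x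

end

end DOAG

namespace DOAG

open Finsupp Filter Topology Set

/-! ### Ordered groups with a `ℚ`-module structure -/

section OrderedModule

variable {M : Type*} [AddCommGroup M] [LinearOrder M] [IsOrderedAddMonoid M] [Module ℚ M]

/-! The one deep implication leads from a convex extension to the interpolation condition: some `f
i` is at most `g` at `x` and at least `g` at `y`. Over `ℝ` one restricts to the segment from `x` to
`y`, where a continuous piecewise affine function always has such a piece
(`exists_le_and_ge_of_piecewise_affine`). That argument uses completeness, so for general `Γ` a
counterexample is written as a first-order property of its parameters (`IsBadGraph`) and moved to
`ℝ`. By Fourier–Motzkin elimination (`exists_sameSigns_sum`) the truth of a formula depends only on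
the signs of finitely many rational linear forms in its parameters, and every sign pattern realised
in `Γ` is realised in `ℝ` (`exists_sameSigns`).

The other implications are formal. Under interpolation, `g` is the minimum, over points `x`, of the
maximum of those `f i` with `f i x ≤ g x`. A min-max is a lattice combination, and the same
combination of the total functions `f i` extends `g` to `Γⁿ`. -/

instance (priority := 50) posSMulStrictMono_rat : PosSMulStrictMono ℚ M where
  smul_lt_smul_of_pos_left q hq a b hab := by
    have hden : (q.den : ℚ) * q = (q.num.toNat : ℚ) := by
      rw [mul_comm, Rat.mul_den_eq_num]
      have : ((q.num.toNat : ℤ) : ℚ) = q.num := by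
        rw [Int.toNat_of_nonneg (Rat.num_nonneg.2 hq.le)]
      exact_mod_cast this.symm
    have key : ∀ x : M, q.den • (q • x) = q.num.toNat • x := fun x => by
      rw [← Nat.cast_smul_eq_nsmul ℚ, ← Nat.cast_smul_eq_nsmul ℚ, smul_smul, hden]
    have hnum : q.num.toNat ≠ 0 := by
      have := Rat.num_pos.2 hq
      omega
    refine lt_of_nsmul_lt_nsmul_right q.den ?_
    simp only [key]
    exact nsmul_lt_nsmul_right hnum hab

lemma densely_ordered_of_rat_module : DenselyOrdered M where
  dense a b hab := by
    have h : (0 : ℚ) < 1 / 2 := by norm_num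
    refine ⟨(1 / 2 : ℚ) • a + (1 / 2 : ℚ) • b, ?_, ?_⟩
    · calc a = (1 / 2 : ℚ) • a + (1 / 2 : ℚ) • a := by rw [← add_smul]; norm_num
        _ < _ := by gcongr
    · calc (1 / 2 : ℚ) • a + (1 / 2 : ℚ) • b < (1 / 2 : ℚ) • b + (1 / 2 : ℚ) • b := by gcongr
        _ = b := by rw [← add_smul]; norm_num

end OrderedModule

/-! ### Transfer between two ordered `ℚ`-vector spaces -/

/-- A finite configuration of points of a dense linear order `N` without endpoints that is ordered
like a configuration in `M` can be extended by a point placed like a given point of `M`. -/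
lemma exists_same_position {M N κ : Type*} [LinearOrder M] [LinearOrder N] [DenselyOrdered N]
    [NoMinOrder N] [NoMaxOrder N] [Nonempty N] (K : Finset κ) (r : κ → M) (s : κ → N)
    (h : ∀ k ∈ K, ∀ l ∈ K, (r k < r l ↔ s k < s l)) (x : M) :
    ∃ y, ∀ k ∈ K, (x < r k ↔ y < s k) ∧ (r k < x ↔ s k < y) := by
  classical
  by_cases hx : ∃ k ∈ K, r k = x
  · obtain ⟨k, hk, rfl⟩ := hx
    exact ⟨s k, fun l hl => ⟨h k hk l hl, h l hl k hk⟩⟩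
  · push Not at hx
    -- Here `x` lies in a gap of the configuration. Density fills the corresponding gap in `N`; the
    -- absence of endpoints covers an empty side.
    obtain ⟨y, hlo, hhi⟩ := Order.exists_between_finsets
      ((K.filter (fun k => r k < x)).image s) ((K.filter (fun k => x < r k)).image s) (by
        simp only [Finset.mem_image, Finset.mem_filter]
        rintro _ ⟨k, ⟨hk, hkx⟩, rfl⟩ _ ⟨l, ⟨hl, hlx⟩, rfl⟩
        exact (h k hk l hl).1 (hkx.trans hlx))
    refine ⟨y, fun k hk => ?_⟩
    rcases lt_or_gt_of_ne (hx k hk) with hlt | hlt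
    · have := hlo (s k) (Finset.mem_image_of_mem _ (Finset.mem_filter.2 ⟨hk, hlt⟩))
      simp [hlt, this, hlt.not_gt, this.not_gt]
    · have := hhi (s k) (Finset.mem_image_of_mem _ (Finset.mem_filter.2 ⟨hk, hlt⟩))
      simp [hlt, this, hlt.not_gt, this.not_gt]

section Transfer

variable {M N : Type*}
  [AddCommGroup M] [LinearOrder M] [Module ℚ M] [AddCommGroup N] [LinearOrder N] [Module ℚ N]
  {α β ι : Type*}

/-- The linear forms in `L` have the same strict positivity at `v` and at `w`. -/
def SameSigns (L : Finset (α →₀ ℚ)) (v : α → M) (w : α → N) : Prop :=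
  ∀ l ∈ L, (0 < linearCombination ℚ v l ↔ 0 < linearCombination ℚ w l)

lemma SameSigns.symm {L : Finset (α →₀ ℚ)} {v : α → M} {w : α → N} (h : SameSigns L v w) :
    SameSigns L w v := fun l hl => (h l hl).symm

lemma SameSigns.mono {L L' : Finset (α →₀ ℚ)} (hL : L ⊆ L') {v : α → M} {w : α → N}
    (h : SameSigns L' v w) : SameSigns L v w := fun l hl => h l (hL hl)

/-- Reindexing of the variables. -/
lemma SameSigns.comp [DecidableEq α] (σ : β → α) {L : Finset (β →₀ ℚ)} {v : α → M} {w : α → N}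
    (h : SameSigns (L.image (mapDomain σ)) v w) : SameSigns L (v ∘ σ) (w ∘ σ) := fun l hl => by
  have := h _ (Finset.mem_image_of_mem _ hl)
  rwa [linearCombination_mapDomain, linearCombination_mapDomain] at this

variable [IsOrderedAddMonoid M] [IsOrderedAddMonoid N]

/-- A linear condition on `x` only sees the side of its root on which `x` lies, or the sign of `a`
when `q = 0`. Hence the two kinds of forms in `eliminate`. -/
lemma pos_smul_add_iff (q : ℚ) (a x : M) :
    0 < q • x + a ↔ (0 < q ∧ -(q⁻¹ • a) < x) ∨ (q < 0 ∧ x < -(q⁻¹ • a)) ∨ (q = 0 ∧ 0 < a) := by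
  rcases lt_trichotomy q 0 with hq | rfl | hq
  · have : q • x + a = (-q) • (-(q⁻¹ • a) - x) := by
      rw [smul_sub, smul_neg, smul_smul, neg_mul, mul_inv_cancel₀ hq.ne]; simp [add_comm]
    rw [this, smul_pos_iff_of_pos_left (neg_pos.2 hq), sub_pos]
    simp [hq, hq.ne, hq.not_gt]
  · simp
  · have : q • x + a = q • (x - -(q⁻¹ • a)) := by
      rw [smul_sub, smul_neg, smul_smul, mul_inv_cancel₀ hq.ne']; simp
    rw [this, smul_pos_iff_of_pos_left hq, sub_pos]
    simp [hq, hq.ne', hq.not_gt]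

/-- The root of a linear form in its first variable, as a linear form in the other ones. -/
noncomputable def root (l : Option α →₀ ℚ) : α →₀ ℚ := -((l none)⁻¹ • l.some)

/-- The linear forms obtained by eliminating the first variable from those in `L`. -/
noncomputable def eliminate [DecidableEq α] (L : Finset (Option α →₀ ℚ)) : Finset (α →₀ ℚ) :=
  L.image Finsupp.some ∪ Finset.image₂ (fun k l => root l - root k) L L

/-- One variable can be added: this is the elimination of one existential quantifier. -/
lemma SameSigns.exists_option [DecidableEq α] [Nontrivial N] {L : Finset (Option α →₀ ℚ)}
    {v : α → M} {w : α → N} (h : SameSigns (eliminate L) v w) (x : M) :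
    ∃ y : N, SameSigns L (fun o => Option.elim o x v) (fun o => Option.elim o y w) := by
  have : DenselyOrdered N := densely_ordered_of_rat_module
  obtain ⟨y, hy⟩ := exists_same_position L (fun l => linearCombination ℚ v (root l))
    (fun l => linearCombination ℚ w (root l)) (fun k hk l hl => by
      have := h (root l - root k) (Finset.mem_union_right _ (Finset.mem_image₂_of_mem hk hl))
      simpa only [map_sub, sub_pos] using this) x
  refine ⟨y, fun l hl => ?_⟩
  have h1 := h l.some (Finset.mem_union_left _ (Finset.mem_image_of_mem _ hl))
  obtain ⟨h2, h3⟩ := hy l hl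
  simp only [root, map_neg, map_smul] at h2 h3
  rw [linearCombination_option, linearCombination_option]
  change 0 < l none • x + linearCombination ℚ v l.some ↔
    0 < l none • y + linearCombination ℚ w l.some
  rw [pos_smul_add_iff, pos_smul_add_iff, h1, h2, h3]

lemma comp_elim_pempty {X : Type*} (v : α → X) (x : PEmpty → X) :
    v ∘ Sum.elim id PEmpty.elim = Sum.elim v x := by
  ext (a | a)
  · rfl
  · exact a.elim

/-- The bijection of sets of variables that moves one variable to the front. -/
def optionVars : α ⊕ Option ι → Option (α ⊕ ι) :=
  Sum.elim (fun a => some (Sum.inl a)) (Option.map Sum.inr)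

lemma elim_comp_optionVars {X : Type*} (v : α → X) (x : Option ι → X) :
    (fun o : Option (α ⊕ ι) => o.elim (x none) (Sum.elim v (x ∘ Option.some))) ∘ optionVars =
      Sum.elim v x := by
  ext (a | _ | a) <;> rfl

variable [Nontrivial M] [Nontrivial N]

variable (M N) in
/-- Finitely many variables can be added. -/
lemma exists_sameSigns_sum (ι : Type*) [Finite ι] : ∀ (L : Finset (α ⊕ ι →₀ ℚ)),
    ∃ L' : Finset (α →₀ ℚ), ∀ (v : α → M) (w : α → N), SameSigns L' v w →
      (∀ x : ι → M, ∃ y : ι → N, SameSigns L (Sum.elim v x) (Sum.elim w y)) ∧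
      ∀ y : ι → N, ∃ x : ι → M, SameSigns L (Sum.elim v x) (Sum.elim w y) := by
  classical
  induction ι using Finite.induction_empty_option with
  | of_equiv e ih =>
    intro L
    obtain ⟨L', h'⟩ := ih (L.image (mapDomain (Sum.map id e.symm)))
    refine ⟨L', fun v w h => ⟨fun x => ?_, fun y => ?_⟩⟩
    · obtain ⟨y, hy⟩ := (h' v w h).1 (x ∘ e)
      refine ⟨y ∘ e.symm, ?_⟩
      simpa [Sum.elim_comp_map, Function.comp_assoc] using hy.comp
    · obtain ⟨x, hx⟩ := (h' v w h).2 (y ∘ e)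
      refine ⟨x ∘ e.symm, ?_⟩
      simpa [Sum.elim_comp_map, Function.comp_assoc] using hx.comp
  | h_empty =>
    intro L
    refine ⟨L.image (mapDomain (Sum.elim id PEmpty.elim)), fun v w h => ⟨fun x => ⟨PEmpty.elim, ?_⟩,
      fun x => ⟨PEmpty.elim, ?_⟩⟩⟩ <;>
    · have := h.comp
      rwa [comp_elim_pempty v, comp_elim_pempty w] at this
  | h_option ih =>
    rename_i ι _
    intro L
    -- The new variable is eliminated, treating the remaining ones as parameters; the induction
    -- hypothesis then removes those.
    obtain ⟨L₁, h₁⟩ := ih (eliminate (L.image (mapDomain optionVars)))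
    refine ⟨L₁, fun v w h => ⟨fun x => ?_, fun y => ?_⟩⟩
    · obtain ⟨y, hy⟩ := (h₁ v w h).1 (x ∘ Option.some)
      obtain ⟨z, hz⟩ := hy.exists_option (x none)
      refine ⟨fun o => o.elim z y, ?_⟩
      rw [← elim_comp_optionVars, ← elim_comp_optionVars]
      exact hz.comp
    · obtain ⟨x, hx⟩ := (h₁ v w h).2 (y ∘ Option.some)
      obtain ⟨z, hz⟩ := hx.symm.exists_option (y none)
      refine ⟨fun o => o.elim z x, ?_⟩
      rw [← elim_comp_optionVars, ← elim_comp_optionVars]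
      exact hz.symm.comp

/-- Every sign pattern realised in one ordered vector space is realised in any other one. -/
lemma exists_sameSigns (L : Finset (α →₀ ℚ)) (v : α → M) : ∃ w : α → N, SameSigns L v w := by
  classical
  -- Only the finitely many variables occurring in `L` matter; all others may be sent to `0`.
  let s : Finset α := L.biUnion Finsupp.support
  let σ : Empty ⊕ s → α := Sum.elim Empty.elim Subtype.val
  have hσ : Function.Injective σ := by
    rintro (a | a) (b | b) hab
    · exact a.elim
    · exact a.elim
    · exact b.elim
    · exact congrArg _ (Subtype.ext hab)
  obtain ⟨L', h'⟩ := exists_sameSigns_sum M N (α := Empty) s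
    (L.image (fun l => l.comapDomain σ hσ.injOn))
  -- Without parameters every linear form is `0`, so the sign hypothesis holds automatically.
  have h' := h' Empty.elim Empty.elim (fun l _ => by
    rw [Subsingleton.elim l 0]; simp)
  obtain ⟨y, hy⟩ := h'.1 (fun a => v a)
  refine ⟨fun a => if ha : a ∈ s then y ⟨a, ha⟩ else 0, fun l hl => ?_⟩
  have hl' : mapDomain σ (l.comapDomain σ hσ.injOn) = l := by
    refine mapDomain_comapDomain σ hσ l fun a ha => ?_
    exact ⟨Sum.inr ⟨a, Finset.mem_biUnion.2 ⟨l, hl, ha⟩⟩, rfl⟩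
  have := hy _ (Finset.mem_image_of_mem _ hl)
  rw [← hl', linearCombination_mapDomain, linearCombination_mapDomain]
  have hv : v ∘ σ = Sum.elim Empty.elim (fun a : s => v a) := by
    ext (a | a)
    · exact a.elim
    · rfl
  have hw : (fun a => if ha : a ∈ s then y ⟨a, ha⟩ else 0) ∘ σ = Sum.elim Empty.elim y := by
    ext (a | a)
    · exact a.elim
    · simp [σ]
  rwa [hv, hw]

end Transfer

/-! ### First-order predicates depend only on signs of linear forms -/

section Transfers

variable {M N : Type*} [AddCommGroup M] [Module ℚ M] [AddCommGroup N] [Module ℚ N]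
  {α β : Type*}

/-- `F` and `G` are the same linear form, over `M` and over `N`. -/
def LinPair (F : (α → M) → M) (G : (α → N) → N) : Prop :=
  ∃ l : α →₀ ℚ, (∀ v, F v = linearCombination ℚ v l) ∧ ∀ w, G w = linearCombination ℚ w l

namespace LinPair

lemma var (a : α) : LinPair (fun v : α → M => v a) (fun w : α → N => w a) :=
  ⟨single a 1, by simp, by simp⟩

lemma zero : LinPair (fun _ : α → M => 0) (fun _ : α → N => 0) := ⟨0, by simp, by simp⟩

variable {F F' : (α → M) → M} {G G' : (α → N) → N}

lemma add (h : LinPair F G) (h' : LinPair F' G') :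
    LinPair (fun v => F v + F' v) (fun w => G w + G' w) := by
  obtain ⟨l, h1, h2⟩ := h
  obtain ⟨l', h1', h2'⟩ := h'
  exact ⟨l + l', by simp [h1, h1'], by simp [h2, h2']⟩

lemma smul (q : ℚ) (h : LinPair F G) : LinPair (fun v => q • F v) (fun w => q • G w) := by
  obtain ⟨l, h1, h2⟩ := h
  exact ⟨q • l, by simp [h1], by simp [h2]⟩

lemma neg (h : LinPair F G) : LinPair (fun v => - F v) (fun w => - G w) := by
  simpa using h.smul (-1)

lemma sub (h : LinPair F G) (h' : LinPair F' G') :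
    LinPair (fun v => F v - F' v) (fun w => G w - G' w) := by
  simpa [sub_eq_add_neg] using h.add h'.neg

lemma sum {ι : Type*} (s : Finset ι) {F : ι → (α → M) → M} {G : ι → (α → N) → N}
    (h : ∀ i, LinPair (F i) (G i)) :
    LinPair (fun v => ∑ i ∈ s, F i v) (fun w => ∑ i ∈ s, G i w) := by
  choose l h1 h2 using h
  exact ⟨∑ i ∈ s, l i, by simp [h1, map_sum], by simp [h2, map_sum]⟩

end LinPair

variable [LinearOrder M] [LinearOrder N]

/-- The predicates `P` over `M` and `Q` over `N` are given by the same Boolean combination of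
linear inequalities. -/
def Transfers (P : (α → M) → Prop) (Q : (α → N) → Prop) : Prop :=
  ∃ L : Finset (α →₀ ℚ), ∀ v w, SameSigns L v w → (P v ↔ Q w)

namespace Transfers

variable {P P' : (α → M) → Prop} {Q Q' : (α → N) → Prop}

lemma not (h : Transfers P Q) : Transfers (fun v => ¬ P v) (fun w => ¬ Q w) := by
  obtain ⟨L, hL⟩ := h
  exact ⟨L, fun v w hvw => not_congr (hL v w hvw)⟩

lemma imp (h : Transfers P Q) (h' : Transfers P' Q') :
    Transfers (fun v => P v → P' v) (fun w => Q w → Q' w) := by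
  classical
  obtain ⟨L, hL⟩ := h
  obtain ⟨L', hL'⟩ := h'
  exact ⟨L ∪ L', fun v w hvw => imp_congr (hL v w (hvw.mono Finset.subset_union_left))
    (hL' v w (hvw.mono Finset.subset_union_right))⟩

lemma and (h : Transfers P Q) (h' : Transfers P' Q') :
    Transfers (fun v => P v ∧ P' v) (fun w => Q w ∧ Q' w) := by
  simpa using (h.imp h'.not).not

lemma forall_finite {ι : Type*} [Finite ι] {P : ι → (α → M) → Prop} {Q : ι → (α → N) → Prop}
    (h : ∀ i, Transfers (P i) (Q i)) : Transfers (fun v => ∀ i, P i v) (fun w => ∀ i, Q i w) := by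
  classical
  have := Fintype.ofFinite ι
  choose L hL using h
  exact ⟨Finset.univ.biUnion L, fun v w hvw => forall_congr' fun i =>
    hL i v w (hvw.mono (Finset.subset_biUnion_of_mem L (Finset.mem_univ i)))⟩

lemma exists_finite {ι : Type*} [Finite ι] {P : ι → (α → M) → Prop} {Q : ι → (α → N) → Prop}
    (h : ∀ i, Transfers (P i) (Q i)) : Transfers (fun v => ∃ i, P i v) (fun w => ∃ i, Q i w) := by
  simpa using (forall_finite fun i => (h i).not).not

lemma reindex {P : (β → M) → Prop} {Q : (β → N) → Prop} (σ : β → α) (h : Transfers P Q) :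
    Transfers (fun v => P (v ∘ σ)) (fun w => Q (w ∘ σ)) := by
  obtain ⟨L, hL⟩ := h
  classical
  exact ⟨_, fun v w hvw => hL _ _ (hvw.comp σ)⟩

variable [IsOrderedAddMonoid M] [IsOrderedAddMonoid N]

lemma lt {F F' : (α → M) → M} {G G' : (α → N) → N} (h : LinPair F G) (h' : LinPair F' G') :
    Transfers (fun v => F v < F' v) (fun w => G w < G' w) := by
  obtain ⟨l, h1, h2⟩ := h'.sub h
  refine ⟨{l}, fun v w hvw => ?_⟩
  have := hvw l (by simp)
  rwa [← h1, ← h2, sub_pos, sub_pos] at this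

lemma le {F F' : (α → M) → M} {G G' : (α → N) → N} (h : LinPair F G) (h' : LinPair F' G') :
    Transfers (fun v => F v ≤ F' v) (fun w => G w ≤ G' w) := by
  simpa using (lt h' h).not

lemma eq {F F' : (α → M) → M} {G G' : (α → N) → N} (h : LinPair F G) (h' : LinPair F' G') :
    Transfers (fun v => F v = F' v) (fun w => G w = G' w) := by
  simpa [le_antisymm_iff] using (le h h').and (le h' h)

variable [Nontrivial M] [Nontrivial N]

/-- Quantifier elimination enters here: both directions of `exists_sameSigns_sum` let a witness be
matched on the other side. -/
lemma exists_tuple {ι : Type*} [Finite ι] {P : (α → M) → (ι → M) → Prop}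
    {Q : (α → N) → (ι → N) → Prop}
    (h : Transfers (fun v : α ⊕ ι → M => P (v ∘ Sum.inl) (v ∘ Sum.inr))
      (fun w : α ⊕ ι → N => Q (w ∘ Sum.inl) (w ∘ Sum.inr))) :
    Transfers (fun v => ∃ x, P v x) (fun w => ∃ y, Q w y) := by
  obtain ⟨L, hL⟩ := h
  obtain ⟨L', hL'⟩ := exists_sameSigns_sum M N ι L
  refine ⟨L', fun v w hvw => ⟨?_, ?_⟩⟩
  · rintro ⟨x, hx⟩
    obtain ⟨y, hy⟩ := (hL' v w hvw).1 x
    exact ⟨y, (hL _ _ hy).1 hx⟩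
  · rintro ⟨y, hy⟩
    obtain ⟨x, hx⟩ := (hL' v w hvw).2 y
    exact ⟨x, (hL _ _ hx).2 hy⟩

lemma forall_tuple {ι : Type*} [Finite ι] {P : (α → M) → (ι → M) → Prop}
    {Q : (α → N) → (ι → N) → Prop}
    (h : Transfers (fun v : α ⊕ ι → M => P (v ∘ Sum.inl) (v ∘ Sum.inr))
      (fun w : α ⊕ ι → N => Q (w ∘ Sum.inl) (w ∘ Sum.inr))) :
    Transfers (fun v => ∀ x, P v x) (fun w => ∀ y, Q w y) := by
  simpa using (exists_tuple (P := fun v x => ¬ P v x) (Q := fun v x => ¬ Q v x) h.not).not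

lemma exists_scalar {P : (α → M) → M → Prop} {Q : (α → N) → N → Prop}
    (h : Transfers (fun v : α ⊕ Unit → M => P (v ∘ Sum.inl) (v (Sum.inr ())))
      (fun w : α ⊕ Unit → N => Q (w ∘ Sum.inl) (w (Sum.inr ())))) :
    Transfers (fun v => ∃ x, P v x) (fun w => ∃ y, Q w y) := by
  have := exists_tuple (P := fun v (x : Unit → M) => P v (x ()))
    (Q := fun v (x : Unit → N) => Q v (x ())) h
  have hM : ∀ v, (∃ x : Unit → M, P v (x ())) ↔ ∃ x, P v x :=
    fun v => ⟨fun ⟨x, hx⟩ => ⟨x (), hx⟩, fun ⟨x, hx⟩ => ⟨fun _ => x, hx⟩⟩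
  have hN : ∀ v, (∃ x : Unit → N, Q v (x ())) ↔ ∃ x, Q v x :=
    fun v => ⟨fun ⟨x, hx⟩ => ⟨x (), hx⟩, fun ⟨x, hx⟩ => ⟨fun _ => x, hx⟩⟩
  simpa only [hM, hN] using this

lemma forall_scalar {P : (α → M) → M → Prop} {Q : (α → N) → N → Prop}
    (h : Transfers (fun v : α ⊕ Unit → M => P (v ∘ Sum.inl) (v (Sum.inr ())))
      (fun w : α ⊕ Unit → N => Q (w ∘ Sum.inl) (w (Sum.inr ())))) :
    Transfers (fun v => ∀ x, P v x) (fun w => ∀ y, Q w y) := by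
  simpa using (exists_scalar (P := fun v x => ¬ P v x) (Q := fun v x => ¬ Q v x) h.not).not

lemma exists_of_exists (h : Transfers P Q) {v : α → M} (hv : P v) : ∃ w, Q w := by
  obtain ⟨L, hL⟩ := h
  obtain ⟨w, hw⟩ := exists_sameSigns (N := N) L v
  exact ⟨w, (hL v w hw).1 hv⟩

end Transfers

/-! ### First-order formulas -/

lemma linPair_term {γ : Type*} (t : oag.Term γ) :
    LinPair (fun v : γ → M => t.realize v) (fun w : γ → N => t.realize w) := by
  induction t with
  | var a => exact LinPair.var a
  | func f ts ih =>
    cases f with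
    | zero => exact LinPair.zero
    | neg => exact (ih 0).neg
    | add => exact (ih 0).add (ih 1)

/-- The renaming of variables that corresponds to `Fin.snoc`. -/
def snocVars {k : ℕ} : β ⊕ Fin (k + 1) → (β ⊕ Fin k) ⊕ Unit :=
  Sum.elim (fun b => Sum.inl (Sum.inl b))
    (Fin.snoc (α := fun _ => (β ⊕ Fin k) ⊕ Unit) (fun i => Sum.inl (Sum.inr i)) (Sum.inr ()))

lemma comp_snocVars_inr {X : Type*} {k : ℕ} (v : (β ⊕ Fin k) ⊕ Unit → X) :
    (v ∘ snocVars) ∘ Sum.inr =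
      (Fin.snoc ((v ∘ Sum.inl) ∘ Sum.inr) (v (Sum.inr ())) : Fin (k + 1) → X) := by
  rw [snocVars, Function.comp_assoc, Sum.elim_comp_inr, Fin.comp_snoc]
  rfl

variable [IsOrderedAddMonoid M] [IsOrderedAddMonoid N] [Nontrivial M] [Nontrivial N]

/-- Terms are linear forms, so atomic formulas compare two of them. For a quantifier, `snocVars`
isolates the bound variable as a separate summand. -/
lemma transfers_boundedFormula {k : ℕ} (φ : oag.BoundedFormula β k) :
    Transfers (fun v : β ⊕ Fin k → M => φ.Realize (v ∘ Sum.inl) (v ∘ Sum.inr))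
      (fun w : β ⊕ Fin k → N => φ.Realize (w ∘ Sum.inl) (w ∘ Sum.inr)) := by
  induction φ with
  | falsum => exact ⟨∅, fun v w _ => Iff.rfl⟩
  | equal t₁ t₂ =>
    simp only [FirstOrder.Language.BoundedFormula.Realize, Sum.elim_comp_inl_inr]
    exact Transfers.eq (linPair_term t₁) (linPair_term t₂)
  | rel R ts =>
    cases R
    simp only [FirstOrder.Language.BoundedFormula.Realize, Sum.elim_comp_inl_inr]
    exact Transfers.le (linPair_term (ts 0)) (linPair_term (ts 1))
  | imp _ _ ih₁ ih₂ => exact ih₁.imp ih₂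
  | @all k φ ih =>
    have h := ih.reindex (snocVars (β := β) (k := k))
    refine Transfers.forall_scalar (P := fun v x => φ.Realize (v ∘ Sum.inl)
      (Fin.snoc (v ∘ Sum.inr) x)) (Q := fun v x => φ.Realize (v ∘ Sum.inl)
      (Fin.snoc (v ∘ Sum.inr) x)) ?_
    simp only [comp_snocVars_inr] at h
    exact h

lemma transfers_formula (φ : oag.Formula β) :
    Transfers (fun v : β → M => φ.Realize v) (fun w : β → N => φ.Realize w) := by
  have := (transfers_boundedFormula (M := M) (N := N) φ).reindex
    (Sum.elim id Fin.elim0 : β ⊕ Fin 0 → β)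
  simpa only [FirstOrder.Language.Formula.Realize, Function.comp_assoc, Sum.elim_comp_inl,
    Function.comp_id, Subsingleton.elim _ (default : Fin 0 → _)] using this

end Transfers

/-! ### Piecewise affine functions on real intervals -/

/-- A continuous function on `[0, 1]` that is pointwise one of finitely many affine functions. -/
lemma exists_le_and_ge_of_piecewise_affine {m : ℕ} (φ : ℝ → ℝ) (a b : Fin m → ℝ)
    (hφ : ContinuousOn φ (Icc 0 1))
    (h : ∀ t ∈ Icc (0 : ℝ) 1, ∃ i, φ t = (1 - t) * a i + t * b i) :
    ∃ i, a i ≤ φ 0 ∧ φ 1 ≤ b i := by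
  by_contra! hcon
  -- Subtracting the chord reduces to a function vanishing at both ends.
  set ψ : ℝ → ℝ := fun t => φ t - ((1 - t) * φ 0 + t * φ 1) with hψ
  set l : Fin m → ℝ → ℝ := fun i t => (1 - t) * (a i - φ 0) + t * (b i - φ 1) with hl
  have hψc : ContinuousOn ψ (Icc 0 1) := hφ.sub (by fun_prop)
  have hψl : ∀ t ∈ Icc (0 : ℝ) 1, ∃ i, ψ t = l i t := fun t ht => by
    obtain ⟨i, hi⟩ := h t ht
    exact ⟨i, by simp only [hψ, hl, hi]; ring⟩
  -- By continuity and finiteness, a piece active close enough to `t` is active at `t`.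
  have hact : ∀ t ∈ Icc (0 : ℝ) 1, ∀ᶠ s in 𝓝[Icc 0 1] t, ∀ i, ψ s = l i s → ψ t = l i t := by
    intro t ht
    refine eventually_all.2 fun i => ?_
    by_cases hi : ψ t = l i t
    · exact Eventually.of_forall fun _ _ => hi
    · have hc : ContinuousWithinAt (fun s => ψ s - l i s) (Icc 0 1) t :=
        (hψc t ht).sub (by fun_prop)
      filter_upwards [hc.eventually_ne (sub_ne_zero.2 hi)] with s hs hs'
      exact absurd (sub_eq_zero.2 hs') hs
  have hψ0 : ψ 0 = 0 := by simp [hψ]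
  have hψ1 : ψ 1 = 0 := by simp [hψ]
  have hneg : ∀ i, a i - φ 0 ≤ 0 → b i - φ 1 < 0 := fun i hi => by
    have := hcon i (by linarith)
    linarith
  -- `ψ` is negative just after `0`
  obtain ⟨η, hη, hη1, hηneg⟩ : ∃ η > 0, η ≤ 1 ∧ ∀ t, 0 < t → t < η → ψ t < 0 := by
    have h0 := hact 0 (by simp)
    rw [eventually_nhdsWithin_iff, Metric.eventually_nhds_iff] at h0
    obtain ⟨η, hη, h0⟩ := h0
    refine ⟨min η 1, by positivity, min_le_right _ _, fun t ht htη => ?_⟩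
    have htη' := lt_min_iff.1 htη
    obtain ⟨i, hi⟩ := hψl t ⟨ht.le, htη'.2.le⟩
    have h2 := h0 (y := t) (by simp [abs_of_pos ht, htη'.1]) ⟨ht.le, htη'.2.le⟩ i hi
    have h3 : a i - φ 0 = 0 := by simpa [hψ0, hl] using h2.symm
    rw [hi]
    simp only [hl, h3, mul_zero, zero_add]
    exact mul_neg_of_pos_of_neg ht (hneg i h3.le)
  have hS : IsCompact (Icc η 1 ∩ ψ ⁻¹' Ici 0) :=
    isCompact_Icc.of_isClosed_subset
      ((hψc.mono (Icc_subset_Icc_left hη.le)).preimage_isClosed_of_isClosed isClosed_Icc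
        isClosed_Ici) inter_subset_left
  -- `s` is the first positive time at which `ψ` is nonnegative again.
  obtain ⟨s, ⟨⟨hηs, hs1⟩, hsψ⟩, hsmin⟩ := hS.exists_isLeast ⟨1, ⟨hη1, le_rfl⟩, hψ1.ge⟩
  have hs0 : 0 < s := hη.trans_le hηs
  have hlt : ∀ t, 0 < t → t < s → ψ t < 0 := fun t ht hts => by
    by_contra! hcon'
    rcases lt_or_ge t η with htη | htη
    · exact absurd (hηneg t ht htη) hcon'.not_gt
    · exact absurd (hsmin ⟨⟨htη, hts.le.trans hs1⟩, hcon'⟩) hts.not_ge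
  have h1 := hact s ⟨hs0.le, hs1⟩
  rw [eventually_nhdsWithin_iff, Metric.eventually_nhds_iff] at h1
  obtain ⟨ε, hε, h1⟩ := h1
  obtain ⟨t, ht, hts⟩ : ∃ t, max 0 (s - ε) < t ∧ t < s := exists_between (by simp [hs0, hε])
  have ht' := max_lt_iff.1 ht
  have htI : t ∈ Icc (0 : ℝ) 1 := ⟨ht'.1.le, hts.le.trans hs1⟩
  -- The piece `j` active just before `s` is negative there and nonnegative at `s`, so it increases.
  -- It thus starts nonpositive and ends nonnegative, against `hneg`.
  obtain ⟨j, hj⟩ := hψl t htI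
  have h2 := h1 (y := t) (by rw [Real.dist_eq, abs_sub_comm, abs_of_pos] <;> linarith) htI j hj
  have h3 := hlt t ht'.1 hts
  have h4 : 0 ≤ ψ s := hsψ
  rw [hj] at h3
  rw [h2] at h4
  simp only [hl] at h3 h4
  have hslope : 0 < (b j - φ 1) - (a j - φ 0) := by
    by_contra! hc
    nlinarith
  have hA : a j - φ 0 ≤ 0 := by nlinarith
  have hB := hneg j hA
  nlinarith

/-- A midpoint convex set that is locally constant on either side of each point is convex. -/
lemma Icc_subset_of_midpoint {B : Set ℝ} (hB : ∀ s ∈ B, ∀ t ∈ B, (s + t) / 2 ∈ B)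
    (h0 : (0 : ℝ) ∈ B) (h1 : (1 : ℝ) ∈ B)
    (hr : ∀ t, (∀ᶠ s in 𝓝[>] t, s ∈ B) ∨ ∀ᶠ s in 𝓝[>] t, s ∉ B)
    (hl : ∀ t, (∀ᶠ s in 𝓝[<] t, s ∈ B) ∨ ∀ᶠ s in 𝓝[<] t, s ∉ B) : Icc 0 1 ⊆ B := by
  have hcl : ∀ s ∈ closure B, ∀ t ∈ closure B, (s + t) / 2 ∈ closure B := fun s hs t ht =>
    map_mem_closure₂ (f := fun s t : ℝ => (s + t) / 2) (by fun_prop) hs ht hB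
  -- The midpoint of the nearest points of `closure B` on either side of `t` is again in `closure
  -- B`, so one of them must be `t`.
  have hdense : Icc 0 1 ⊆ closure B := by
    intro t ht
    obtain ⟨a, ⟨ha, ha0, hat⟩, ha'⟩ := ((isCompact_Icc (a := (0 : ℝ)) (b := t)).inter_left
      (isClosed_closure (s := B))).exists_isGreatest ⟨0, subset_closure h0, le_rfl, ht.1⟩
    obtain ⟨b, ⟨hb, htb, hb1⟩, hb'⟩ := ((isCompact_Icc (a := t) (b := (1 : ℝ))).inter_left
      (isClosed_closure (s := B))).exists_isLeast ⟨1, subset_closure h1, ht.2, le_rfl⟩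
    have hab := hcl a ha b hb
    rcases le_total ((a + b) / 2) t with hle | hle
    · have := ha' ⟨hab, by linarith, hle⟩
      rwa [show t = a by linarith]
    · have := hb' ⟨hab, hle, by linarith⟩
      rwa [show t = b by linarith]
  intro t ht
  rcases ht.1.eq_or_lt with rfl | ht0
  · exact h0
  rcases ht.2.eq_or_lt with rfl | ht1
  · exact h1
  have hmeet : ∀ u v : ℝ, 0 ≤ u → u < v → v ≤ 1 → ∃ s ∈ Ioo u v, s ∈ B := fun u v hu huv hv =>
    mem_closure_iff.1 (hdense (show (u + v) / 2 ∈ Icc 0 1 from ⟨by linarith, by linarith⟩))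
      (Ioo u v) isOpen_Ioo ⟨by linarith, by linarith⟩
  -- Density rules out that a one-sided neighbourhood avoids `B`; then `t` is the midpoint of some
  -- `t + ε` and `t - ε` in `B`.
  have hR : ∀ᶠ s in 𝓝[>] t, s ∈ B := (hr t).resolve_right fun hc => by
    obtain ⟨u, htu, hu⟩ := (mem_nhdsGT_iff_exists_Ioo_subset' ht1).1 hc
    obtain ⟨s, hs, hsB⟩ := hmeet t (min u 1) ht0.le (lt_min htu ht1) (min_le_right _ _)
    exact hu ⟨hs.1, hs.2.trans_le (min_le_left _ _)⟩ hsB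
  have hL : ∀ᶠ s in 𝓝[<] t, s ∈ B := (hl t).resolve_right fun hc => by
    obtain ⟨u, htu, hu⟩ := (mem_nhdsLT_iff_exists_Ioo_subset' ht0).1 hc
    obtain ⟨s, hs, hsB⟩ := hmeet (max u 0) t (le_max_right _ _) (max_lt htu ht0) ht1.le
    exact hu ⟨(le_max_left _ _).trans_lt hs.1, hs.2⟩ hsB
  obtain ⟨u, htu, hu⟩ := (mem_nhdsGT_iff_exists_Ioo_subset' ht1).1 hR
  obtain ⟨w, htw, hw⟩ := (mem_nhdsLT_iff_exists_Ioo_subset' ht0).1 hL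
  obtain ⟨ε, hε, hε'⟩ := exists_between (show 0 < min (u - t) (t - w) from
    lt_min (sub_pos.2 htu) (sub_pos.2 htw))
  have hε2 := lt_min_iff.1 hε'
  have := hB (t + ε) (hu ⟨by linarith, by linarith⟩) (t - ε) (hw ⟨by linarith, by linarith⟩)
  rwa [show (t + ε + (t - ε)) / 2 = t by ring] at this

lemma eventually_pos_or_not_pos (a b t : ℝ) :
    ((∀ᶠ s in 𝓝[>] t, 0 < (1 - s) * a + s * b) ∨ ∀ᶠ s in 𝓝[>] t, ¬ 0 < (1 - s) * a + s * b) ∧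
    ((∀ᶠ s in 𝓝[<] t, 0 < (1 - s) * a + s * b) ∨ ∀ᶠ s in 𝓝[<] t, ¬ 0 < (1 - s) * a + s * b) := by
  have hc : Continuous fun s : ℝ => (1 - s) * a + s * b := by fun_prop
  rcases lt_trichotomy ((1 - t) * a + t * b) 0 with h | h | h
  · have := (hc.tendsto t).eventually (eventually_lt_nhds h)
    exact ⟨.inr ((this.mono fun _ hs => hs.not_gt).filter_mono nhdsWithin_le_nhds),
      .inr ((this.mono fun _ hs => hs.not_gt).filter_mono nhdsWithin_le_nhds)⟩
  · have key : ∀ s, (1 - s) * a + s * b = (s - t) * (b - a) := fun s => by linear_combination h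
    simp only [key]
    constructor
    · rcases le_or_gt (b - a) 0 with hab | hab
      · exact .inr (eventually_nhdsWithin_of_forall fun s hs =>
          (mul_nonpos_of_nonneg_of_nonpos (sub_pos.2 hs).le hab).not_gt)
      · exact .inl (eventually_nhdsWithin_of_forall fun s hs => mul_pos (sub_pos.2 hs) hab)
    · rcases le_or_gt 0 (b - a) with hab | hab
      · exact .inr (eventually_nhdsWithin_of_forall fun s hs =>
          (mul_nonpos_of_nonpos_of_nonneg (sub_neg.2 hs).le hab).not_gt)
      · exact .inl (eventually_nhdsWithin_of_forall fun s hs =>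
          mul_pos_of_neg_of_neg (sub_neg.2 hs) hab)
  · have := (hc.tendsto t).eventually (eventually_gt_nhds h)
    exact ⟨.inl (this.filter_mono nhdsWithin_le_nhds), .inl (this.filter_mono nhdsWithin_le_nhds)⟩

lemma linearCombination_lineMap {α : Type*} (v w : α → ℝ) (l : α →₀ ℚ) (t : ℝ) :
    linearCombination ℚ (fun a => (1 - t) * v a + t * w a) l =
      (1 - t) * linearCombination ℚ v l + t * linearCombination ℚ w l := by
  simp only [linearCombination_apply, Finsupp.sum, Finset.mul_sum, ← Finset.sum_add_distrib,
    Rat.smul_def]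
  exact Finset.sum_congr rfl fun a _ => by ring

/-- The trace on a line of a Boolean combination of linear inequalities is locally constant on
either side of each point. -/
lemma Transfers.eventually_or {α : Type*} {P : (α → ℝ) → Prop} (h : Transfers P P) (v w : α → ℝ)
    (t : ℝ) :
    ((∀ᶠ s in 𝓝[>] t, P fun a => (1 - s) * v a + s * w a) ∨
      ∀ᶠ s in 𝓝[>] t, ¬ P fun a => (1 - s) * v a + s * w a) ∧
    ((∀ᶠ s in 𝓝[<] t, P fun a => (1 - s) * v a + s * w a) ∨
      ∀ᶠ s in 𝓝[<] t, ¬ P fun a => (1 - s) * v a + s * w a) := by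
  obtain ⟨L, hL⟩ := h
  set p : ℝ → α → ℝ := fun s a => (1 - s) * v a + s * w a
  have key : ∀ F : Filter ℝ, (∀ l ∈ L, (∀ᶠ s in F, 0 < linearCombination ℚ (p s) l) ∨
      ∀ᶠ s in F, ¬ 0 < linearCombination ℚ (p s) l) →
      (∀ᶠ s in F, P (p s)) ∨ ∀ᶠ s in F, ¬ P (p s) := by
    intro F hF
    -- All signs in `L` stabilise along `F`, and they determine the truth of `P`.
    have hev : ∀ᶠ s in F, ∀ l ∈ L, (0 < linearCombination ℚ (p s) l ↔
        ∀ᶠ s in F, 0 < linearCombination ℚ (p s) l) := by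
      refine (Finset.eventually_all L).2 fun l hl => ?_
      by_cases h : ∀ᶠ s in F, 0 < linearCombination ℚ (p s) l
      · filter_upwards [h] with s hs using by simp [hs, h]
      · filter_upwards [(hF l hl).resolve_left h] with s hs using by simp [hs, h]
    by_cases h : ∀ᶠ s in F, ¬ P (p s)
    · exact .inr h
    · obtain ⟨s₀, hs₀, hP⟩ := ((not_eventually.1 h).and_eventually hev).exists
      left
      filter_upwards [hev] with s hs
      exact (hL _ _ fun l hl => (hs l hl).trans (hP l hl).symm).2 (not_not.1 hs₀)
  constructor
  · refine key _ fun l _ => ?_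
    simp only [p, linearCombination_lineMap]
    exact (eventually_pos_or_not_pos _ _ t).1
  · refine key _ fun l _ => ?_
    simp only [p, linearCombination_lineMap]
    exact (eventually_pos_or_not_pos _ _ t).2

/-! ### Counterexamples as a first-order property of their parameters -/

section Graph

variable {M N : Type*} [AddCommGroup M] [Module ℚ M] [AddCommGroup N] [Module ℚ N]
  {α β : Type*} {n m : ℕ}

/-- The affine function with slopes `q` and constant term `c a`. -/
def affine (q : Fin n → ℚ) (a : β) (c : β → M) (x : Fin n → M) : M := ∑ j, q j • x j + c a

lemma linPair_affine (q : Fin n → ℚ) (b : β → α) (a : β) (x : Fin n → α) :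
    LinPair (fun v : α → M => affine q a (fun k => v (b k)) (fun j => v (x j)))
      (fun w : α → N => affine q a (fun k => w (b k)) (fun j => w (x j))) :=
  (LinPair.sum _ fun j => (LinPair.var (x j)).smul (q j)).add (LinPair.var (b a))

variable [LinearOrder M] [LinearOrder N]

/-- With the parameters `c`, the formula `φ` defines the graph of a continuous function with
midpoint convex domain that is pointwise one of the functions `affine (q i) (a i) c`, but has a pair
of values between which none of these functions passes. -/
def IsBadGraph (φ : oag.Formula (β ⊕ Option (Fin n))) (q : Fin m → Fin n → ℚ)
    (a : Fin m → β) (c : β → M) : Prop :=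
  (∀ p : Option (Fin n) → M, φ.Realize (Sum.elim c p) →
    ∃ i, p none = affine (q i) (a i) c (fun j => p (some j))) ∧
  (∀ p : Option (Fin n) → M, ∀ p' : Option (Fin n) → M, φ.Realize (Sum.elim c p) →
    φ.Realize (Sum.elim c p') → ∃ p'' : Option (Fin n) → M, φ.Realize (Sum.elim c p'') ∧
      ∀ j, p'' (some j) = (1 / 2 : ℚ) • (p (some j) + p' (some j))) ∧
  (∀ p : Option (Fin n) → M, φ.Realize (Sum.elim c p) → ∀ ε, 0 < ε → ∃ δ, 0 < δ ∧
    ∀ p' : Option (Fin n) → M, φ.Realize (Sum.elim c p') →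
      (∀ j, p' (some j) < p (some j) + δ ∧ p (some j) < p' (some j) + δ) →
      p' none < p none + ε ∧ p none < p' none + ε) ∧
  ∃ p : Option (Fin n) → M, ∃ p' : Option (Fin n) → M, φ.Realize (Sum.elim c p) ∧
    φ.Realize (Sum.elim c p') ∧ ∀ i, ¬ (affine (q i) (a i) c (fun j => p (some j)) ≤ p none ∧
      p' none ≤ affine (q i) (a i) c (fun j => p' (some j)))

variable [IsOrderedAddMonoid M] [IsOrderedAddMonoid N] [Nontrivial M] [Nontrivial N]

lemma transfers_realize_elim {γ : Type*} (φ : oag.Formula (β ⊕ γ)) (b : β → α) (x : γ → α) :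
    Transfers (fun v : α → M => φ.Realize (Sum.elim (v ∘ b) (v ∘ x)))
      (fun w : α → N => φ.Realize (Sum.elim (w ∘ b) (w ∘ x))) := by
  have := (transfers_formula (M := M) (N := N) φ).reindex (Sum.elim b x)
  simpa only [Sum.comp_elim] using this

variable (M N) in
-- The proof follows the syntax of `IsBadGraph`. Each quantifier adds a summand of variables, so the
-- depth of `Sum.inl` counts the quantifiers crossed.
lemma transfers_isBadGraph (φ : oag.Formula (β ⊕ Option (Fin n))) (q : Fin m → Fin n → ℚ)
    (a : Fin m → β) :
    Transfers (fun c : β → M => IsBadGraph φ q a c) (fun c : β → N => IsBadGraph φ q a c) := by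
  simp only [IsBadGraph]
  refine .and ?_ <| .and ?_ <| .and ?_ ?_
  · refine .forall_tuple ?_
    refine .imp (transfers_realize_elim φ (fun k => Sum.inl k) (fun o => Sum.inr o)) ?_
    refine .exists_finite fun i => .eq (.var _) ?_
    exact linPair_affine (q i) (fun k => Sum.inl k) (a i) (fun j => Sum.inr (some j))
  · refine .forall_tuple <| .forall_tuple ?_
    refine .imp (transfers_realize_elim φ (fun k => Sum.inl (Sum.inl k))
      (fun o => Sum.inl (Sum.inr o))) ?_
    refine .imp (transfers_realize_elim φ (fun k => Sum.inl (Sum.inl k)) (fun o => Sum.inr o)) ?_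
    refine .exists_tuple <| .and
      (transfers_realize_elim φ (fun k => Sum.inl (Sum.inl (Sum.inl k))) (fun o => Sum.inr o)) ?_
    exact .forall_finite fun j => .eq (.var _) (.smul _ (.add (.var _) (.var _)))
  · refine .forall_tuple ?_
    refine .imp (transfers_realize_elim φ (fun k => Sum.inl k) (fun o => Sum.inr o)) ?_
    refine .forall_scalar <| .imp (.lt .zero (.var _)) ?_
    refine .exists_scalar <| .and (.lt .zero (.var _)) ?_
    refine .forall_tuple <| .imp (transfers_realize_elim φ
      (fun k => Sum.inl (Sum.inl (Sum.inl (Sum.inl k)))) (fun o => Sum.inr o)) ?_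
    refine .imp (.forall_finite fun j => ?_) ?_
    all_goals
      refine .and ?_ ?_ <;> exact .lt (.var _) (.add (.var _) (.var _))
  · refine .exists_tuple <| .exists_tuple ?_
    refine .and (transfers_realize_elim φ (fun k => Sum.inl (Sum.inl k))
      (fun o => Sum.inl (Sum.inr o))) ?_
    refine .and (transfers_realize_elim φ (fun k => Sum.inl (Sum.inl k)) (fun o => Sum.inr o)) ?_
    refine .forall_finite fun i => .not (.and (.le ?_ (.var _)) (.le (.var _) ?_))
    · exact linPair_affine (q i) (fun k => Sum.inl (Sum.inl k)) (a i)
        (fun j => Sum.inl (Sum.inr (some j)))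
    · exact linPair_affine (q i) (fun k => Sum.inl (Sum.inl k)) (a i) (fun j => Sum.inr (some j))

lemma affine_lineMap (q : Fin n → ℚ) (a : β) (c : β → ℝ) (x y : Fin n → ℝ) (t : ℝ) :
    affine q a c (fun j => (1 - t) * x j + t * y j) =
      (1 - t) * affine q a c x + t * affine q a c y := by
  have : ∑ j, q j • ((1 - t) * x j + t * y j) =
      (1 - t) * ∑ j, q j • x j + t * ∑ j, q j • y j := by
    simp only [Finset.mul_sum, ← Finset.sum_add_distrib, Rat.smul_def]
    exact Finset.sum_congr rfl fun j _ => by ring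
  rw [affine, affine, affine, this]
  ring

/-- There is no bad graph over the real numbers. -/
lemma not_isBadGraph_real (φ : oag.Formula (β ⊕ Option (Fin n))) (q : Fin m → Fin n → ℚ)
    (a : Fin m → β) (c : β → ℝ) : ¬ IsBadGraph φ q a c := by
  rintro ⟨haff, hmid, hcont, p, p', hp, hp', hbad⟩
  set seg : ℝ → Fin n → ℝ := fun t j => (1 - t) * p (some j) + t * p' (some j) with hseg
  set pt : (Fin n → ℝ) → ℝ → Option (Fin n) → ℝ := fun x y o => o.elim y x with hpt
  have hpt_eq : ∀ r : Option (Fin n) → ℝ, pt (fun j => r (some j)) (r none) = r := fun r => by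
    ext (_ | j) <;> rfl
  -- Single-valuedness is not part of `IsBadGraph`; it follows from the continuity clause applied to
  -- two points over the same `x`.
  have huniq : ∀ x y y', φ.Realize (Sum.elim c (pt x y)) → φ.Realize (Sum.elim c (pt x y')) →
      y ≤ y' := fun x y y' hy hy' => by
    refine le_of_forall_pos_lt_add fun ε hε => ?_
    obtain ⟨δ, hδ, h⟩ := hcont _ hy ε hε
    exact (h _ hy' fun j => by simpa [hpt] using hδ).2
  set B : Set ℝ := {t | ∃ y, φ.Realize (Sum.elim c (pt (seg t) y))} with hB
  have h0 : φ.Realize (Sum.elim c (pt (seg 0) (p none))) := by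
    have : seg 0 = fun j => p (some j) := by simp [hseg]
    rwa [this, hpt_eq]
  have h1 : φ.Realize (Sum.elim c (pt (seg 1) (p' none))) := by
    have : seg 1 = fun j => p' (some j) := by simp [hseg]
    rwa [this, hpt_eq]
  have hBmid : ∀ s ∈ B, ∀ t ∈ B, (s + t) / 2 ∈ B := by
    rintro s ⟨y, hy⟩ t ⟨z, hz⟩
    obtain ⟨r, hr, hrj⟩ := hmid _ _ hy hz
    refine ⟨r none, ?_⟩
    have : seg ((s + t) / 2) = fun j => r (some j) := by
      ext j
      rw [hrj]
      simp only [hseg, hpt, Option.elim, Rat.smul_def]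
      push_cast
      ring
    rwa [this, hpt_eq]
  have hT : Transfers
      (fun v : β ⊕ Fin n → ℝ => ∃ y, φ.Realize (Sum.elim (v ∘ Sum.inl) (pt (v ∘ Sum.inr) y)))
      (fun v : β ⊕ Fin n → ℝ => ∃ y, φ.Realize (Sum.elim (v ∘ Sum.inl) (pt (v ∘ Sum.inr) y))) := by
    refine .exists_scalar ?_
    have := transfers_realize_elim (M := ℝ) (N := ℝ) φ
      (fun k => (Sum.inl (Sum.inl k) : (β ⊕ Fin n) ⊕ Unit))
      (fun o => o.elim (Sum.inr ()) fun j => Sum.inl (Sum.inr j))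
    have hv : ∀ v : (β ⊕ Fin n) ⊕ Unit → ℝ,
        (v ∘ fun o : Option (Fin n) => o.elim (Sum.inr ()) fun j => Sum.inl (Sum.inr j)) =
          pt ((v ∘ Sum.inl) ∘ Sum.inr) (v (Sum.inr ())) := fun v => by
      ext (_ | j) <;> rfl
    simp only [hv] at this
    exact this
  -- The parameters are interpolated along with the points; both ends being `c`, they stay constant.
  have hBT : ∀ t, t ∈ B ↔ ∃ y, φ.Realize (Sum.elim
      ((fun k => (1 - t) * Sum.elim c (fun j => p (some j)) k +
        t * Sum.elim c (fun j => p' (some j)) k) ∘ Sum.inl)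
      (pt ((fun k => (1 - t) * Sum.elim c (fun j => p (some j)) k +
        t * Sum.elim c (fun j => p' (some j)) k) ∘ Sum.inr) y)) := fun t => by
    have h1 : ((fun k => (1 - t) * Sum.elim c (fun j => p (some j)) k +
        t * Sum.elim c (fun j => p' (some j)) k) ∘ Sum.inl) = c := by
      ext k
      simp only [Function.comp, Sum.elim_inl]
      ring
    rw [h1]
    rfl
  have hloc := fun t => hT.eventually_or (Sum.elim c fun j => p (some j))
    (Sum.elim c fun j => p' (some j)) t
  simp only [← hBT] at hloc
  have hsub : Icc 0 1 ⊆ B := Icc_subset_of_midpoint hBmid ⟨_, h0⟩ ⟨_, h1⟩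
    (fun t => (hloc t).1) (fun t => (hloc t).2)
  choose! γ hγ using hsub
  have hγc : ContinuousOn γ (Icc 0 1) := by
    intro t ht
    rw [ContinuousWithinAt, Metric.tendsto_nhds]
    intro ε hε
    obtain ⟨δ, hδ, h⟩ := hcont _ (hγ ht) ε hε
    have hev : ∀ᶠ s in 𝓝[Icc 0 1] t, ∀ j, seg s j < seg t j + δ ∧ seg t j < seg s j + δ := by
      refine eventually_all.2 fun j => Filter.Eventually.filter_mono nhdsWithin_le_nhds ?_
      have hc : Continuous fun s => seg s j := by fun_prop
      have h1 := (hc.tendsto t).eventually (eventually_lt_nhds (lt_add_of_pos_right (seg t j) hδ))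
      have h2 := (hc.tendsto t).eventually (eventually_gt_nhds (sub_lt_self (seg t j) hδ))
      filter_upwards [h1, h2] with s hs1 hs2 using ⟨hs1, by linarith⟩
    filter_upwards [hev, self_mem_nhdsWithin] with s hs hsI
    have := h _ (hγ hsI) hs
    rw [Real.dist_eq, abs_lt]
    simp only [hpt, Option.elim] at this
    constructor <;> linarith [this.1, this.2]
  obtain ⟨i, hi0, hi1⟩ := exists_le_and_ge_of_piecewise_affine γ
    (fun i => affine (q i) (a i) c fun j => p (some j))
    (fun i => affine (q i) (a i) c fun j => p' (some j)) hγc (fun t ht => by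
      obtain ⟨i, hi⟩ := haff _ (hγ ht)
      refine ⟨i, ?_⟩
      rw [← affine_lineMap]
      exact hi)
  refine hbad i ⟨hi0.trans ?_, le_trans ?_ hi1⟩
  · exact huniq _ _ _ (hγ (by simp)) h0
  · exact huniq _ _ _ h1 (hγ (by simp))

lemma not_isBadGraph (φ : oag.Formula (β ⊕ Option (Fin n))) (q : Fin m → Fin n → ℚ)
    (a : Fin m → β) (c : β → M) : ¬ IsBadGraph φ q a c := fun h => by
  obtain ⟨w, hw⟩ := (transfers_isBadGraph M ℝ φ q a).exists_of_exists h
  exact not_isBadGraph_real φ q a w hw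

end Graph

section Extension

variable {Γ : Type*} [AddCommGroup Γ] [LinearOrder Γ] {n m : ℕ}

/-! ### Definability of inequalities between affine functions -/

lemma IsDefinable.of_and {α : Type*} {P Q R : (α → Γ) → Prop} (hP : IsDefinable {v | P v})
    (hQ : IsDefinable {v | Q v}) (h : ∀ v, R v ↔ P v ∧ Q v) : IsDefinable {v | R v} := by
  rw [show {v | R v} = {v | P v} ∩ {v | Q v} from Set.ext h]
  exact Set.Definable.inter hP hQ

lemma IsDefinable.of_or {α : Type*} {P Q R : (α → Γ) → Prop} (hP : IsDefinable {v | P v})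
    (hQ : IsDefinable {v | Q v}) (h : ∀ v, R v ↔ P v ∨ Q v) : IsDefinable {v | R v} := by
  rw [show {v | R v} = {v | P v} ∪ {v | Q v} from Set.ext h]
  exact Set.Definable.union hP hQ

/-- Some positive multiple of `F` is given by a term with parameters. -/
def IsRatTerm {α : Type*} (F : (α → Γ) → Γ) : Prop :=
  ∃ N : ℕ, 0 < N ∧ ∃ t : oag.Term ((univ : Set Γ) ⊕ α), ∀ v,
    t.realize (Sum.elim Subtype.val v) = N • F v

lemma exists_nsmul_term {γ : Type*} (t : oag.Term γ) (k : ℕ) :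
    ∃ t' : oag.Term γ, ∀ v : γ → Γ, t'.realize v = k • t.realize v := by
  induction k with
  | zero => exact ⟨.func OagFunc.zero ![], fun v => by rw [zero_smul]; rfl⟩
  | succ k ih =>
    obtain ⟨t', ht'⟩ := ih
    refine ⟨.func OagFunc.add ![t', t], fun v => ?_⟩
    rw [succ_nsmul, ← ht']
    rfl

lemma exists_zsmul_term {γ : Type*} (t : oag.Term γ) (k : ℤ) :
    ∃ t' : oag.Term γ, ∀ v : γ → Γ, t'.realize v = k • t.realize v := by
  obtain ⟨k, rfl | rfl⟩ := k.eq_nat_or_neg <;> obtain ⟨t', ht'⟩ := exists_nsmul_term (Γ := Γ) t k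
  · exact ⟨t', fun v => by rw [ht', natCast_zsmul]⟩
  · refine ⟨.func OagFunc.neg ![t'], fun v => ?_⟩
    rw [neg_smul, natCast_zsmul, ← ht']
    rfl

namespace IsRatTerm

variable {α : Type*} {F G : (α → Γ) → Γ}

lemma var (a : α) : IsRatTerm (fun v : α → Γ => v a) :=
  ⟨1, one_pos, .var (.inr a), fun v => by simp⟩

lemma const (c : Γ) : IsRatTerm (fun _ : α → Γ => c) :=
  ⟨1, one_pos, .var (.inl ⟨c, mem_univ c⟩), fun v => by simp⟩

lemma add (hF : IsRatTerm F) (hG : IsRatTerm G) : IsRatTerm (fun v => F v + G v) := by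
  obtain ⟨N, hN, t, ht⟩ := hF
  obtain ⟨N', hN', t', ht'⟩ := hG
  obtain ⟨s, hs⟩ := exists_nsmul_term (Γ := Γ) t N'
  obtain ⟨s', hs'⟩ := exists_nsmul_term (Γ := Γ) t' N
  refine ⟨N * N', mul_pos hN hN', .func OagFunc.add ![s, s'], fun v => ?_⟩
  change s.realize _ + s'.realize _ = _
  rw [hs, hs', ht, ht', smul_add, smul_smul, smul_smul, mul_comm N']

lemma smul [Module ℚ Γ] (q : ℚ) (hF : IsRatTerm F) : IsRatTerm (fun v => q • F v) := by
  obtain ⟨N, hN, t, ht⟩ := hF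
  obtain ⟨s, hs⟩ := exists_zsmul_term (Γ := Γ) t q.num
  refine ⟨N * q.den, mul_pos hN q.pos, s, fun v => ?_⟩
  rw [hs, ht, ← Nat.cast_smul_eq_nsmul ℚ, ← Nat.cast_smul_eq_nsmul ℚ, ← Int.cast_smul_eq_zsmul ℚ,
    smul_smul, smul_smul, Nat.cast_mul, mul_assoc, Rat.den_mul_eq_num, mul_comm]

lemma sum {ι : Type*} (s : Finset ι) {F : ι → (α → Γ) → Γ} (h : ∀ i, IsRatTerm (F i)) :
    IsRatTerm (fun v => ∑ i ∈ s, F i v) := by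
  classical
  induction s using Finset.induction_on with
  | empty => simpa using const 0
  | insert i s hi ih => simpa [Finset.sum_insert hi] using (h i).add ih

/-- Terms have integer coefficients, so denominators are cleared by a common positive multiple,
which does not affect the inequality. -/
lemma definable_le [IsOrderedAddMonoid Γ] (hF : IsRatTerm F) (hG : IsRatTerm G) :
    IsDefinable {v | F v ≤ G v} := by
  obtain ⟨N, hN, t, ht⟩ := hF
  obtain ⟨N', hN', t', ht'⟩ := hG
  obtain ⟨s, hs⟩ := exists_nsmul_term (Γ := Γ) t N'
  obtain ⟨s', hs'⟩ := exists_nsmul_term (Γ := Γ) t' N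
  refine Set.definable_iff_exists_formula_sum.2
    ⟨FirstOrder.Language.Relations.formula₂ (L := oag) OagRel.le s s', ?_⟩
  ext v
  refine Iff.trans ?_ FirstOrder.Language.Formula.realize_rel₂.symm
  change F v ≤ G v ↔ s.realize _ ≤ s'.realize _
  rw [hs, hs', ht, ht', smul_smul, smul_smul, mul_comm N',
    nsmul_le_nsmul_iff_right (mul_pos hN hN').ne']

end IsRatTerm

/-! ### The lattice generated by the affine functions -/

variable [TopologicalSpace Γ]

/-- The properties of the elements of the lattice generated by the affine functions `f i`. -/
structure IsTame (f : Fin m → (Fin n → Γ) → Γ) (h : (Fin n → Γ) → Γ) : Prop where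
  continuous : Continuous h
  definable_le : IsDefinable {v : Option (Fin n) → Γ | h (fun j => v (some j)) ≤ v none}
  definable_ge : IsDefinable {v : Option (Fin n) → Γ | v none ≤ h (fun j => v (some j))}
  isWCombination : IsWCombination h f

lemma hasWExtension_univ_of_isTame {f : Fin m → (Fin n → Γ) → Γ} {D : Set (Fin n → Γ)} {g : D → Γ}
    {h : (Fin n → Γ) → Γ} (H : IsTame f h) (hg : ∀ x : D, h x = g x) :
    HasWExtension f g univ := by
  refine ⟨subset_univ D, fun x => h x, H.continuous.comp continuous_subtype_val,
    H.definable_le.of_and H.definable_ge fun v => ?_, fun x => H.isWCombination x, hg⟩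
  simp [le_antisymm_iff]

variable [OrderTopology Γ]

/-- Under `⊔` the sets above the graphs intersect and those below unite. This is why `IsTame`
records two inequalities rather than the graph. -/
lemma IsTame.sup {f : Fin m → (Fin n → Γ) → Γ} {h h' : (Fin n → Γ) → Γ} (H : IsTame f h)
    (H' : IsTame f h') : IsTame f (h ⊔ h') where
  continuous := H.continuous.sup H'.continuous
  definable_le := H.definable_le.of_and H'.definable_le fun _ => sup_le_iff
  definable_ge := H.definable_ge.of_or H'.definable_ge fun _ => le_sup_iff
  isWCombination x := by
    rcases max_choice (h x) (h' x) with hx | hx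
    · exact (H.isWCombination x).imp fun i hi => hx.trans hi
    · exact (H'.isWCombination x).imp fun i hi => hx.trans hi

lemma IsTame.inf {f : Fin m → (Fin n → Γ) → Γ} {h h' : (Fin n → Γ) → Γ} (H : IsTame f h)
    (H' : IsTame f h') : IsTame f (h ⊓ h') where
  continuous := H.continuous.inf H'.continuous
  definable_le := H.definable_le.of_or H'.definable_le fun _ => inf_le_iff
  definable_ge := H.definable_ge.of_and H'.definable_ge fun _ => le_inf_iff
  isWCombination x := by
    rcases min_choice (h x) (h' x) with hx | hx
    · exact (H.isWCombination x).imp fun i hi => hx.trans hi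
    · exact (H'.isWCombination x).imp fun i hi => hx.trans hi

variable [IsOrderedAddMonoid Γ] [Module ℚ Γ]

/-- Scaling by a positive rational is an order isomorphism, hence continuous for the order topology.
-/
lemma continuous_rat_smul (q : ℚ) : Continuous fun x : Γ => q • x := by
  rcases lt_trichotomy q 0 with hq | rfl | hq
  · have := (OrderIso.smulRight (β := Γ) (neg_pos.2 hq)).continuous.neg
    convert this using 2 with x
    change q • x = -((-q) • x)
    simp
  · simpa using continuous_const
  · exact (OrderIso.smulRight (β := Γ) hq).continuous

lemma isTame_of_isQAffine {f : Fin m → (Fin n → Γ) → Γ} {i : Fin m} (hf : IsQAffine (f i)) :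
    IsTame f (f i) := by
  obtain ⟨q, c, hqc⟩ := hf
  have hrat : IsRatTerm fun v : Option (Fin n) → Γ => f i fun j => v (some j) := by
    simp only [hqc]
    exact (IsRatTerm.sum _ fun j => (IsRatTerm.var (some j)).smul (q j)).add (IsRatTerm.const c)
  refine ⟨?_, hrat.definable_le (.var none), (IsRatTerm.var none).definable_le hrat,
    fun x => ⟨i, rfl⟩⟩
  rw [show f i = _ from funext hqc]
  exact (continuous_finsetSum _ fun j _ =>
    (continuous_rat_smul (q j)).comp (continuous_apply j)).add continuous_const

/-- `ℓ`-combinations extend to `ℓ`-combinations. -/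
lemma hasWExtension_univ_of_isLCombination {f : Fin m → (Fin n → Γ) → Γ}
    (hf : ∀ i, IsQAffine (f i)) {D : Set (Fin n → Γ)} {g : D → Γ}
    (hg : IsLCombination g (fun i (x : D) => f i x)) : HasWExtension f g univ := by
  suffices ∃ h, IsTame f h ∧ ∀ x : D, h x = g x by
    obtain ⟨h, H, hh⟩ := this
    exact hasWExtension_univ_of_isTame H hh
  unfold IsLCombination at hg
  induction hg using latticeClosure_sup_inf_induction with
  | mem g hg =>
    obtain ⟨i, rfl⟩ := hg
    exact ⟨f i, isTame_of_isQAffine (hf i), fun _ => rfl⟩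
  | sup g _ g' _ ih ih' =>
    obtain ⟨h, H, hh⟩ := ih
    obtain ⟨h', H', hh'⟩ := ih'
    exact ⟨h ⊔ h', H.sup H', fun x => by simp [hh, hh']⟩
  | inf g _ g' _ ih ih' =>
    obtain ⟨h, H, hh⟩ := ih
    obtain ⟨h', H', hh'⟩ := ih'
    exact ⟨h ⊓ h', H.inf H', fun x => by simp [hh, hh']⟩

/-! ### Functions on convex definable sets -/

/-- Continuity is put into the first-order form used in `IsBadGraph`, with `ε` and `δ` taken in `Γ`.
-/
lemma exists_delta_of_continuous [Nontrivial Γ] {D : Set (Fin n → Γ)} {g : D → Γ}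
    (hg : Continuous g) (x : D) {ε : Γ} (hε : 0 < ε) : ∃ δ, 0 < δ ∧ ∀ y : D,
      (∀ j, y.1 j < x.1 j + δ ∧ x.1 j < y.1 j + δ) → g y < g x + ε ∧ g x < g y + ε := by
  have : DenselyOrdered Γ := densely_ordered_of_rat_module
  have hnhds : {y : D | |g y - g x| < ε} ∈ 𝓝 x :=
    (hg.tendsto x).eventually ((nhds_basis_abs_sub_lt (g x)).mem_of_mem hε)
  rw [nhds_subtype_eq_comap, mem_comap, nhds_pi] at hnhds
  obtain ⟨U, hU, hUg⟩ := hnhds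
  obtain ⟨⟨I, η⟩, ⟨-, hη⟩, hηU⟩ :=
    (hasBasis_pi fun j => nhds_basis_abs_sub_lt (x.1 j)).mem_iff.1 hU
  have hev : ∀ᶠ δ in 𝓝[>] (0 : Γ), ∀ j, j ∈ I → δ < η j := eventually_all.2 fun j => by
    by_cases hj : j ∈ I
    · exact (mem_of_superset (Ioo_mem_nhdsGT (hη j hj)) fun δ hδ _ => hδ.2)
    · exact Eventually.of_forall fun δ h => absurd h hj
  obtain ⟨δ, hδ, hδ0⟩ := (hev.and self_mem_nhdsWithin).exists
  refine ⟨δ, hδ0, fun y hy => ?_⟩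
  have hyU : y.1 ∈ U := hηU fun j hj => by
    refine lt_trans (abs_lt.2 ⟨?_, ?_⟩) (hδ j hj)
    · rw [neg_lt, neg_sub, sub_lt_iff_lt_add']
      exact (hy j).2
    · rw [sub_lt_iff_lt_add']
      exact (hy j).1
  obtain ⟨h1, h2⟩ := abs_lt.1 (hUg hyU)
  rw [neg_lt, neg_sub] at h1
  exact ⟨sub_lt_iff_lt_add'.1 h2, sub_lt_iff_lt_add'.1 h1⟩

/-- Between two values of a continuous definable piecewise affine function on a convex set passes
one of the affine functions. -/
lemma exists_le_and_ge_of_isConvex {f : Fin m → (Fin n → Γ) → Γ} (hf : ∀ i, IsQAffine (f i))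
    {D : Set (Fin n → Γ)} (hD : IsConvex D) {g : D → Γ} (hgc : Continuous g)
    (hgd : IsDefinableFun g) (hgw : IsWCombination g (fun i (x : D) => f i x)) (x y : D) :
    ∃ i, f i x ≤ g x ∧ g y ≤ f i y := by
  rcases subsingleton_or_nontrivial Γ with hΓ | hΓ
  · obtain ⟨i, -⟩ := hgw x
    exact ⟨i, (Subsingleton.elim _ _).le, (Subsingleton.elim _ _).le⟩
  by_contra! hcon
  choose q c hqc using hf
  obtain ⟨φ, hφ⟩ := Set.definable_iff_exists_formula_sum.1 hgd
  have hφ' : ∀ v : Option (Fin n) → Γ, φ.Realize (Sum.elim Subtype.val v) ↔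
      ∃ h : (fun j => v (some j)) ∈ D, g ⟨fun j => v (some j), h⟩ = v none := fun v =>
    (Set.ext_iff.1 hφ v).symm
  have haff : ∀ i z, affine (q i) (⟨c i, mem_univ _⟩ : (univ : Set Γ)) Subtype.val z = f i z :=
    fun i z => (hqc i z).symm
  -- Every element of `Γ` is a parameter, so the constants `c i` are parameters naming themselves.
  refine not_isBadGraph (β := (univ : Set Γ)) φ q (fun i => ⟨c i, mem_univ _⟩)
    (fun a : (univ : Set Γ) => (a : Γ)) ?_
  simp only [IsBadGraph, haff, hφ']
  refine ⟨?_, ?_, ?_, ?_⟩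
  · rintro p ⟨hp, hpg⟩
    rw [← hpg]
    exact hgw _
  · rintro p p' ⟨hp, -⟩ ⟨hp', -⟩
    have h := hD _ hp _ hp'
    exact ⟨fun o => o.elim (g ⟨_, h⟩)
      ((1 / 2 : ℚ) • ((fun j => p (some j)) + fun j => p' (some j))),
      ⟨h, rfl⟩, fun j => rfl⟩
  · rintro p ⟨hp, hpg⟩ ε hε
    obtain ⟨δ, hδ, h⟩ := exists_delta_of_continuous hgc ⟨_, hp⟩ hε
    refine ⟨δ, hδ, ?_⟩
    rintro p' ⟨hp', hpg'⟩ hj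
    rw [← hpg, ← hpg']
    exact h ⟨_, hp'⟩ hj
  · refine ⟨fun o => o.elim (g x) x, fun o => o.elim (g y) y, ⟨x.2, rfl⟩, ⟨y.2, rfl⟩, ?_⟩
    rintro i ⟨h1, h2⟩
    exact (hcon i h1).not_ge h2

end Extension

/-! ### Minima of maxima -/

section MinMax

variable {Γ : Type*} [LinearOrder Γ] {m : ℕ}

lemma exists_inf'_sup'_of_exists_le_and_ge {X : Type*} (hm : 1 ≤ m) {f : Fin m → X → Γ} {g : X → Γ}
    (hgw : IsWCombination g f) (h : ∀ x y, ∃ i, f i x ≤ g x ∧ g y ≤ f i y) :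
    ∃ (S : Finset {X : Finset (Fin m) // X.Nonempty}) (hS : S.Nonempty),
      ∀ x, g x = S.inf' hS (fun X => X.1.sup' X.2 (fun i => f i x)) := by
  classical
  rcases isEmpty_or_nonempty X with hX | ⟨⟨x₀⟩⟩
  -- On an empty domain any nonempty `S` works; `1 ≤ m` supplies an index.
  · exact ⟨{⟨{⟨0, hm⟩}, Finset.singleton_nonempty _⟩}, Finset.singleton_nonempty _, isEmptyElim⟩
  let A : X → {X : Finset (Fin m) // X.Nonempty} := fun x =>
    ⟨Finset.univ.filter fun i => f i x ≤ g x, (hgw x).imp fun i hi => by simp [hi]⟩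
  have hA : ∀ x i, i ∈ (A x).1 ↔ f i x ≤ g x := fun x i => by simp [A]
  -- At `y`, interpolation makes the maximum over each `A x` at least `g y`, while the maximum over
  -- `A y` is at most `g y`.
  refine ⟨Finset.univ.filter (· ∈ range A), ⟨A x₀, by simp⟩, fun y => le_antisymm ?_ ?_⟩
  · refine Finset.le_inf' _ _ fun Y hY => ?_
    obtain ⟨x, rfl⟩ := (Finset.mem_filter.1 hY).2
    obtain ⟨i, hi, hi'⟩ := h x y
    exact hi'.trans (Finset.le_sup' (fun i => f i y) ((hA x i).2 hi))
  · exact (Finset.inf'_le _ (by simp : A y ∈ _)).trans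
      (Finset.sup'_le _ _ fun i hi => (hA y i).1 hi)

lemma isLCombination_inf'_sup' {X : Type*} {f : Fin m → X → Γ} {g : X → Γ}
    {S : Finset {X : Finset (Fin m) // X.Nonempty}} (hS : S.Nonempty)
    (h : ∀ x, g x = S.inf' hS (fun X => X.1.sup' X.2 (fun i => f i x))) : IsLCombination g f := by
  have hg : g = S.inf' hS (fun X => X.1.sup' X.2 f) := by
    ext x
    rw [h, Finset.inf'_apply]
    simp only [Finset.sup'_apply]
  rw [hg]
  exact isSublattice_latticeClosure.infClosed.finsetInf'_mem hS fun Y _ =>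
    isSublattice_latticeClosure.supClosed.finsetSup'_mem Y.2 fun i _ =>
      subset_latticeClosure (mem_range_self i)

end MinMax

end DOAG

theorem mainTheorem8 {Γ : Type*} [AddCommGroup Γ] [LinearOrder Γ] [IsOrderedAddMonoid Γ]
    [Module ℚ Γ] [TopologicalSpace Γ] [OrderTopology Γ]
    {n m : ℕ} (hm : 1 ≤ m)
    (f : Fin m → (Fin n → Γ) → Γ) (hf : ∀ i, DOAG.IsQAffine (f i))
    (D : Set (Fin n → Γ)) (hD : DOAG.IsDefinable D)
    (g : D → Γ) (hgc : Continuous g) (hgd : DOAG.IsDefinableFun g)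
    (hgw : DOAG.IsWCombination g (fun i (x : D) => f i x)) :
    List.TFAE [
      DOAG.IsLCombination g (fun i (x : D) => f i x),
      DOAG.HasWExtension f g Set.univ,
      ∃ D' : Set (Fin n → Γ), DOAG.IsDefinable D' ∧ DOAG.IsConvex D' ∧
        DOAG.HasWExtension f g D',
      ∀ x y : D, ∃ i, f i x ≤ g x ∧ g y ≤ f i y,
      ∃ (S : Finset {X : Finset (Fin m) // X.Nonempty}) (hS : S.Nonempty),
        ∀ x : D, g x = S.inf' hS (fun X => X.1.sup' X.2 (fun i => f i x))] := by
  tfae_have 1 → 2 := DOAG.hasWExtension_univ_of_isLCombination hf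
  tfae_have 2 → 3 := fun h =>
    ⟨Set.univ, Set.definable_univ, fun _ _ _ _ => Set.mem_univ _, h⟩
  tfae_have 3 → 4 := by
    rintro ⟨D', -, hconv, hDD', g', hc, hd, hw, hg⟩ x y
    rw [← hg, ← hg]
    exact DOAG.exists_le_and_ge_of_isConvex hf hconv hc hd hw ⟨x, hDD' x.2⟩ ⟨y, hDD' y.2⟩
  tfae_have 4 → 5 := DOAG.exists_inf'_sup'_of_exists_le_and_ge hm hgw
  tfae_have 5 → 1 := fun ⟨S, hS, h⟩ => DOAG.isLCombination_inf'_sup' hS h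
  tfae_finish
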